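/- **Theorem.** Let $m\ge 2$, let $D\subset\mathbb{R}^m$ be a bounded domain (a non-empty, open, connected, bounded set) and let $\lambda>0$. Let $J_\nu$ denote the Bessel function of the first kind of order $\nu$, let $j_{\nu,1}$ be its first positive zero, and put, for $t>0$, $$a^\circ(t)=\Gamma\!\left(\tfrac m2\right)\frac{J_{(m-2)/2}(t)}{(t/2)^{(m-2)/2}},\qquad a^\bullet(t)=\Gamma\!\left(\tfrac m2+1\right)\frac{J_{m/2}(t)}{(t/2)^{m/2}} .$$ Write $B_r(x)=\{y:|y-x|<r\}$, $S_r(x)=\partial B_r(x)$, $A_x(r_1,r_2)=\{y: r_1<|x-y|<r_2\}$, let $|\cdot|$ denote volume, and let $$M^\bullet(D',u)=\frac1{|D'|}\int_{D'}u(y)\,\mathrm{d}y,\qquad M^\circ(S_r(x),u)=\frac1{\omega_m}\int_{S_1(0)}u(x+ry)\,\mathrm{d}S_y$$ be the volume mean and the spherical mean, where $\mathrm{d}S$ is surface measure and $\omega_m=2\pi^{m/2}/\Gamma(m/2)$ is the area of the unit sphere. Let $u:D\to\mathbb{R}$ be continuous. Suppose that for every $x\in D$ and all $r_1,r_2$ with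 $0<r_1<r_2<j_{(m-2)/2,1}/\lambda$ and $\overline{B_{r_2}(x)}\subset D$, the identity $$M^\bullet(A_x(r_1,r_2),u)=\frac{a^\bullet(\lambda r_2)\,|B_{r_2}(x)|-a^\bullet(\lambda r_1)\,|B_{r_1}(x)|}{a^\circ(\lambda r)\,|A_x(r_1,r_2)|}\,M^\circ(S_r(x),u)$$ holds either for every $r\in(r_1,r_2)$, or for $r=r_1$, or for $r=r_2$. Then $u$ is metaharmonic in $D$: $u\in C^2(D)$ and $\Delta u+\lambda^2u=0$ in $D$. -/

import Mathlib

open MeasureTheory Metric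
open scoped InnerProductSpace

noncomputable section

namespace Metaharmonic

/-- The Bessel function of the first kind `J_ν`, by its power series (used for `ν ≥ 0`, `t > 0`). -/
def besselJ (ν t : ℝ) : ℝ :=
  ∑' k : ℕ, (-1) ^ k / ((k.factorial : ℝ) * Real.Gamma (k + ν + 1)) * (t / 2) ^ (2 * (k : ℝ) + ν)

/-- The first positive zero `j_{ν,1}` of `J_ν`. -/
def besselFirstZero (ν : ℝ) : ℝ :=
  sInf {t : ℝ | 0 < t ∧ besselJ ν t = 0}

/-- The coefficient `a°(t) = Γ(m/2) J_{(m-2)/2}(t) / (t/2)^{(m-2)/2}` of the spherical mean. -/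
def aSphere (m : ℕ) (t : ℝ) : ℝ :=
  Real.Gamma ((m : ℝ) / 2) * besselJ (((m : ℝ) - 2) / 2) t / (t / 2) ^ (((m : ℝ) - 2) / 2)

/-- The coefficient `a•(t) = Γ(m/2 + 1) J_{m/2}(t) / (t/2)^{m/2}` of the volume mean. -/
def aBall (m : ℕ) (t : ℝ) : ℝ :=
  Real.Gamma ((m : ℝ) / 2 + 1) * besselJ ((m : ℝ) / 2) t / (t / 2) ^ ((m : ℝ) / 2)

/-- The open annulus `A_x(r₁, r₂)`. -/
def annulus {m : ℕ} (x : EuclideanSpace ℝ (Fin m)) (r₁ r₂ : ℝ) : Set (EuclideanSpace ℝ (Fin m)) :=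
  {y | r₁ < dist x y ∧ dist x y < r₂}

/-- The volume mean `M•(D', u)`: the integral over `D'` divided by the volume of `D'`. -/
def volumeMean {m : ℕ} (D' : Set (EuclideanSpace ℝ (Fin m))) (u : EuclideanSpace ℝ (Fin m) → ℝ) :
    ℝ :=
  (volume.real D')⁻¹ * ∫ y in D', u y

/-- The spherical mean `M°(S_r(x), u) = (1/ω_m) ∫_{S_1(0)} u(x + r y) dS_y`, where `dS` is the
surface measure of the unit sphere and `ω_m` is its total mass. -/
def sphericalMean {m : ℕ} (x : EuclideanSpace ℝ (Fin m)) (r : ℝ)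
    (u : EuclideanSpace ℝ (Fin m) → ℝ) : ℝ :=
  ((volume : Measure (EuclideanSpace ℝ (Fin m))).toSphere.real Set.univ)⁻¹ *
    ∫ y : sphere (0 : EuclideanSpace ℝ (Fin m)) 1,
      u (x + r • (y : EuclideanSpace ℝ (Fin m))) ∂(volume.toSphere)

/-- The annular quadrature identity with centre `x`, annulus radii `r₁, r₂` and sphere radius `r`. -/
def AnnularIdentity {m : ℕ} (lam : ℝ) (u : EuclideanSpace ℝ (Fin m) → ℝ)
    (x : EuclideanSpace ℝ (Fin m)) (r₁ r₂ r : ℝ) : Prop :=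
  volumeMean (annulus x r₁ r₂) u =
    (aBall m (lam * r₂) * volume.real (ball x r₂) - aBall m (lam * r₁) * volume.real (ball x r₁)) /
      (aSphere m (lam * r) * volume.real (annulus x r₁ r₂)) * sphericalMean x r u

/-- `u` is metaharmonic in the open set `D`: a `C²` solution of `Δu + λ²u = 0` in `D`. -/
def IsMetaharmonicOn {m : ℕ} (lam : ℝ) (u : EuclideanSpace ℝ (Fin m) → ℝ)
    (D : Set (EuclideanSpace ℝ (Fin m))) : Prop :=
  ContDiffOn ℝ 2 u D ∧ ∀ x ∈ D, Laplacian.laplacian u x + lam ^ 2 * u x = 0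

end Metaharmonic

end

/-!
In polar coordinates about `x` the annular identity says that the mean of the function
`g s = M°(S_s(x), u) / a°(λ s)` over `(r₁, r₂)`, with respect to the positive weight
`s ^ (m - 1) * a°(λ s)`, equals `g r`; here the numerator on the right is, up to a constant factor,
the integral of the weight, because `s ^ m * a•(λ s)` is an antiderivative of
`m * s ^ (m - 1) * a°(λ s)`. By continuity `r` may be taken to be an endpoint, and a continuous
function whose weighted mean over every interval is its value at one of the endpoints is constant.
Letting `s → 0` gives the mean value formula `M°(S_s(x), u) = a°(λ s) u(x)`.

Integrated against a radial bump kernel, this formula exhibits `u` locally as a constant multiple of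
a mollification of itself, so `u` is smooth. Comparing the second-order expansions
`M°(S_s(x), u) = u(x) + s² Δu(x) / (2m) + o(s²)` and `a°(λ s) = 1 - λ² s² / (2m) + o(s²)` gives the
equation.
-/

namespace Metaharmonic

open Set Filter Topology

section BesselClifford

/-- The power series coefficients `1 / (k! Γ(k + ν + 1))` of the Bessel–Clifford function; they have
the correct value `0` at the poles of the Gamma function because `Real.Gamma` vanishes there. -/
noncomputable def besselCliffordCoeff (ν : ℝ) (k : ℕ) : ℝ :=
  ((k.factorial : ℝ) * Real.Gamma (k + ν + 1))⁻¹

/-- The Bessel–Clifford function, the entire function `C_ν` with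
`J_ν(t) = (t / 2) ^ ν * C_ν(-t ^ 2 / 4)`. -/
noncomputable def besselClifford (ν x : ℝ) : ℝ :=
  ∑' k : ℕ, besselCliffordCoeff ν k * x ^ k

lemma besselCliffordCoeff_succ_mul (ν : ℝ) (k : ℕ) :
    besselCliffordCoeff ν (k + 1) * (k + 1) = besselCliffordCoeff (ν + 1) k := by
  have h : ((k + 1 : ℕ) : ℝ) + ν + 1 = k + (ν + 1) + 1 := by push_cast; ring
  rw [besselCliffordCoeff, besselCliffordCoeff, h, Nat.factorial_succ, Nat.cast_mul, mul_assoc,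
    mul_inv, ← Nat.cast_succ, mul_comm, mul_inv_cancel_left₀ (Nat.cast_ne_zero.2 k.succ_ne_zero)]

lemma mul_besselCliffordCoeff_add_one (ν : ℝ) (k : ℕ) :
    (k + ν + 1) * besselCliffordCoeff (ν + 1) k = besselCliffordCoeff ν k := by
  rcases eq_or_ne ((k : ℝ) + ν + 1) 0 with h | h
  · rw [besselCliffordCoeff, besselCliffordCoeff, h, Real.Gamma_zero, zero_mul, mul_zero, inv_zero]
  · rw [besselCliffordCoeff, besselCliffordCoeff, ← add_assoc, Real.Gamma_add_one h,
      mul_left_comm, mul_inv, mul_inv_cancel_left₀ h]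

lemma summable_besselCliffordCoeff_mul_pow (ν x : ℝ) :
    Summable fun k => besselCliffordCoeff ν k * x ^ k := by
  refine Summable.of_norm_bounded_eventually_nat (Real.summable_pow_div_factorial |x|) ?_
  filter_upwards [tendsto_natCast_atTop_atTop.eventually_ge_atTop (1 - ν)] with k hk
  have hΓ : 1 ≤ Real.Gamma (k + ν + 1) := by
    have h2 : 2 ≤ k + ν + 1 := by linarith
    simpa only [Real.Gamma_two] using Real.Gamma_strictMonoOn_Ici.monotoneOn self_mem_Ici h2 h2
  rw [norm_mul, norm_pow, Real.norm_eq_abs, Real.norm_eq_abs, besselCliffordCoeff,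
    abs_of_nonneg (by positivity), div_eq_inv_mul]
  gcongr
  exact le_mul_of_one_le_right (by positivity) hΓ

lemma hasDerivAt_besselClifford (ν x : ℝ) :
    HasDerivAt (besselClifford ν) (besselClifford (ν + 1) x) x := by
  have hterm : ∀ (k : ℕ) (y : ℝ), besselCliffordCoeff ν (k + 1) * ((k + 1 : ℕ) * y ^ (k + 1 - 1)) =
      besselCliffordCoeff (ν + 1) k * y ^ k := fun k y => by
    rw [← besselCliffordCoeff_succ_mul, Nat.add_sub_cancel, Nat.cast_succ, mul_assoc]
  have hsum : ∀ y : ℝ, Summable fun k : ℕ => besselCliffordCoeff ν k * (k * y ^ (k - 1)) :=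
    fun y => (summable_nat_add_iff 1).1 <|
      (summable_besselCliffordCoeff_mul_pow (ν + 1) y).congr fun k => (hterm k y).symm
  have hderiv : ∑' k : ℕ, besselCliffordCoeff ν k * (k * x ^ (k - 1)) =
      besselClifford (ν + 1) x := by
    rw [(hsum x).tsum_eq_zero_add, Nat.cast_zero, zero_mul, mul_zero, zero_add]
    exact tsum_congr fun k => hterm k x
  have hx : x ∈ ball (0 : ℝ) (|x| + 1) := by simp
  rw [← hderiv]
  refine hasDerivAt_tsum_of_isPreconnected (hsum (|x| + 1)).norm isOpen_ball
    (convex_ball _ _).isPreconnected (fun k y _ => (hasDerivAt_pow k y).const_mul _)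
    (fun k y hy => ?_) hx (summable_besselCliffordCoeff_mul_pow ν x) hx
  have hy' : |y| ≤ |(|x| + 1)| :=
    (mem_ball_zero_iff.1 hy).le.trans (le_abs_self _)
  simp only [norm_mul, norm_pow, Real.norm_eq_abs]
  gcongr

lemma besselClifford_zero (ν : ℝ) : besselClifford ν 0 = (Real.Gamma (ν + 1))⁻¹ := by
  rw [besselClifford, tsum_eq_single 0 fun k hk => by rw [zero_pow hk, mul_zero]]
  simp [besselCliffordCoeff]

lemma besselClifford_recurrence (ν x : ℝ) :
    besselClifford ν x =
      (ν + 1) * besselClifford (ν + 1) x + x * besselClifford (ν + 2) x := by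
  have hterm : ∀ k : ℕ, ((k + 1 : ℕ) : ℝ) * besselCliffordCoeff (ν + 1) (k + 1) * x ^ (k + 1) =
      x * (besselCliffordCoeff (ν + 2) k * x ^ k) := fun k => by
    rw [show ν + 2 = ν + 1 + 1 by ring, ← besselCliffordCoeff_succ_mul (ν + 1), Nat.cast_succ]
    ring
  have hsum : Summable fun k : ℕ => k * besselCliffordCoeff (ν + 1) k * x ^ k :=
    (summable_nat_add_iff 1).1 <|
      ((summable_besselCliffordCoeff_mul_pow (ν + 2) x).mul_left x).congr fun k => (hterm k).symm
  have hshift : ∑' k : ℕ, k * besselCliffordCoeff (ν + 1) k * x ^ k =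
      x * besselClifford (ν + 2) x := by
    rw [hsum.tsum_eq_zero_add, Nat.cast_zero, zero_mul, zero_mul, zero_add, besselClifford,
      ← tsum_mul_left]
    exact tsum_congr hterm
  rw [← hshift, besselClifford, besselClifford, ← tsum_mul_left,
    ← ((summable_besselCliffordCoeff_mul_pow (ν + 1) x).mul_left (ν + 1)).tsum_add hsum]
  refine tsum_congr fun k => ?_
  rw [← mul_besselCliffordCoeff_add_one]
  ring

lemma besselJ_eq_rpow_mul_besselClifford (ν : ℝ) {t : ℝ} (ht : 0 < t) :
    besselJ ν t = (t / 2) ^ ν * besselClifford ν (-(t ^ 2 / 4)) := by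
  have hsq : (t / 2) ^ (2 : ℝ) = t ^ 2 / 4 := by rw [Real.rpow_two]; ring
  rw [besselJ, besselClifford, ← tsum_mul_left]
  refine tsum_congr fun k => ?_
  rw [Real.rpow_add (by positivity), Real.rpow_mul (by positivity), Real.rpow_natCast, hsq,
    besselCliffordCoeff, neg_pow (t ^ 2 / 4)]
  ring

end BesselClifford

section BesselNormalized

/-- The Bessel function normalized to take the value `1` at the origin, i.e. the even entire
function `Γ(ν + 1) (2 / t) ^ ν J_ν(t)`. For `t > 0`, `aSphere m` and `aBall m` are its instances
`ν = (m - 2) / 2` and `ν = m / 2`. -/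
noncomputable def besselNormalized (ν t : ℝ) : ℝ :=
  Real.Gamma (ν + 1) * besselClifford ν (-(t ^ 2 / 4))

lemma aSphere_eq_besselNormalized (m : ℕ) {t : ℝ} (ht : 0 < t) :
    aSphere m t = besselNormalized (((m : ℝ) - 2) / 2) t := by
  have hpow : (t / 2) ^ (((m : ℝ) - 2) / 2) ≠ 0 := by positivity
  rw [aSphere, besselJ_eq_rpow_mul_besselClifford _ ht, mul_left_comm,
    mul_div_cancel_left₀ _ hpow, besselNormalized, show ((m : ℝ) - 2) / 2 + 1 = m / 2 by ring]

lemma aBall_eq_besselNormalized (m : ℕ) {t : ℝ} (ht : 0 < t) :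
    aBall m t = besselNormalized ((m : ℝ) / 2) t := by
  have hpow : (t / 2) ^ ((m : ℝ) / 2) ≠ 0 := by positivity
  rw [aBall, besselJ_eq_rpow_mul_besselClifford _ ht, mul_left_comm,
    mul_div_cancel_left₀ _ hpow, besselNormalized]

lemma hasDerivAt_neg_sq_div_four (t : ℝ) : HasDerivAt (fun t : ℝ => -(t ^ 2 / 4)) (-(t / 2)) t := by
  refine ((hasDerivAt_pow 2 t).div_const 4).neg.congr_deriv ?_
  norm_num
  ring

lemma continuous_besselNormalized (ν : ℝ) : Continuous (besselNormalized ν) := by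
  have hC : Continuous (besselClifford ν) :=
    continuous_iff_continuousAt.2 fun x => (hasDerivAt_besselClifford ν x).continuousAt
  unfold besselNormalized
  fun_prop

variable {ν t : ℝ}

lemma besselNormalized_zero (hν : -1 < ν) : besselNormalized ν 0 = 1 := by
  have hΓ : Real.Gamma (ν + 1) ≠ 0 := (Real.Gamma_pos_of_pos (by linarith)).ne'
  rw [besselNormalized, zero_pow two_ne_zero, zero_div, neg_zero, besselClifford_zero,
    mul_inv_cancel₀ hΓ]

lemma besselJ_eq_zero_iff (hν : -1 < ν) (ht : 0 < t) :
    besselJ ν t = 0 ↔ besselNormalized ν t = 0 := by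
  have hpow : (t / 2) ^ ν ≠ 0 := by positivity
  have hΓ : Real.Gamma (ν + 1) ≠ 0 := (Real.Gamma_pos_of_pos (by linarith)).ne'
  rw [besselJ_eq_rpow_mul_besselClifford _ ht, besselNormalized, mul_eq_zero_iff_left hpow,
    mul_eq_zero_iff_left hΓ]

lemma hasDerivAt_besselNormalized (hν : -1 < ν) (t : ℝ) :
    HasDerivAt (besselNormalized ν) (-(t / (2 * (ν + 1))) * besselNormalized (ν + 1) t) t := by
  have hν1 : ν + 1 ≠ 0 := by linarith
  refine (((hasDerivAt_besselClifford ν _).comp t (hasDerivAt_neg_sq_div_four t)).const_mul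
    (Real.Gamma (ν + 1))).congr_deriv ?_
  rw [besselNormalized, Real.Gamma_add_one hν1]
  field_simp

lemma besselNormalized_recurrence (hν : -1 < ν) (t : ℝ) :
    besselNormalized ν t = besselNormalized (ν + 1) t -
      t ^ 2 / (4 * (ν + 1) * (ν + 2)) * besselNormalized (ν + 2) t := by
  have hν1 : ν + 1 ≠ 0 := by linarith
  have hν2 : ν + 1 + 1 ≠ 0 := by linarith
  rw [besselNormalized, besselNormalized, besselNormalized, besselClifford_recurrence ν,
    show ν + 2 = ν + 1 + 1 by ring, Real.Gamma_add_one hν2, Real.Gamma_add_one hν1]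
  field_simp
  ring

lemma hasDerivAt_rpow_mul_besselNormalized (hν : -1 < ν) (ht : 0 < t) :
    HasDerivAt (fun t => t ^ (2 * ν + 2) * besselNormalized (ν + 1) t)
      ((2 * ν + 2) * (t ^ (2 * ν + 1) * besselNormalized ν t)) t := by
  have hν1 : ν + 1 ≠ 0 := by linarith
  have hν2 : ν + 1 + 1 ≠ 0 := by linarith
  have hpow : t ^ (2 * ν + 2) = t ^ (2 * ν + 1) * t := by
    rw [← Real.rpow_add_one ht.ne']
    ring_nf
  refine ((Real.hasDerivAt_rpow_const (.inl ht.ne')).mul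
    (hasDerivAt_besselNormalized (ν := ν + 1) (by linarith) t)).congr_deriv ?_
  rw [besselNormalized_recurrence hν t, hpow, show 2 * ν + 2 - 1 = 2 * ν + 1 by ring,
    show ν + 2 = ν + 1 + 1 by ring]
  field_simp
  ring

lemma tendsto_besselNormalized_sub_one_div_sq (hν : -1 < ν) (lam : ℝ) :
    Tendsto (fun r => (besselNormalized ν (lam * r) - 1) / r ^ 2) (𝓝[>] 0)
      (𝓝 (-(lam ^ 2 / (4 * (ν + 1))))) := by
  have hν1 : ν + 1 ≠ 0 := by linarith
  have hΓ : Real.Gamma (ν + 1) ≠ 0 := (Real.Gamma_pos_of_pos (by linarith)).ne'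
  have hderiv : HasDerivAt (fun y => Real.Gamma (ν + 1) * besselClifford ν (-(lam ^ 2 / 4) * y))
      (-(lam ^ 2 / (4 * (ν + 1)))) 0 := by
    refine (((hasDerivAt_besselClifford ν _).comp 0 ((hasDerivAt_id' (0 : ℝ)).const_mul
      (-(lam ^ 2 / 4)))).const_mul (Real.Gamma (ν + 1))).congr_deriv ?_
    rw [mul_zero, besselClifford_zero, Real.Gamma_add_one hν1]
    field_simp
  have hsq : Tendsto (fun r : ℝ => r ^ 2) (𝓝[>] 0) (𝓝[≠] 0) := by
    refine tendsto_nhdsWithin_iff.2 ⟨?_, ?_⟩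
    · exact ((continuous_pow 2).tendsto' 0 0 (zero_pow two_ne_zero)).mono_left nhdsWithin_le_nhds
    · filter_upwards [self_mem_nhdsWithin] with r hr using (pow_pos hr 2).ne'
  refine (hderiv.tendsto_slope_zero.comp hsq).congr fun r => ?_
  rw [Function.comp_apply, zero_add, mul_zero, besselClifford_zero, mul_inv_cancel₀ hΓ,
    smul_eq_mul, ← div_eq_inv_mul, besselNormalized,
    show -(lam ^ 2 / 4) * r ^ 2 = -((lam * r) ^ 2 / 4) by ring]

lemma besselNormalized_pos_of_ne_zero (hν : -1 < ν) (ht : 0 ≤ t)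
    (hne : ∀ s ∈ Ioc 0 t, besselNormalized ν s ≠ 0) : 0 < besselNormalized ν t := by
  by_contra! hle
  obtain ⟨s, hs, hs0⟩ := intermediate_value_Icc' ht (continuous_besselNormalized ν).continuousOn
    ⟨hle, (besselNormalized_zero hν).symm ▸ zero_le_one⟩
  rcases hs.1.eq_or_lt with rfl | hs'
  · exact one_ne_zero ((besselNormalized_zero hν).symm.trans hs0)
  · exact hne s ⟨hs', hs.2⟩ hs0

lemma besselNormalized_add_one_pos (hν : -1 < ν) (ht : 0 ≤ t)
    (hpos : ∀ s ∈ Ioo 0 t, 0 < besselNormalized ν s) : 0 < besselNormalized (ν + 1) t := by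
  rcases ht.eq_or_lt with rfl | ht
  · rw [besselNormalized_zero (by linarith)]
    exact one_pos
  have hexp : 0 < 2 * ν + 2 := by linarith
  have hmono : StrictMonoOn (fun s => s ^ (2 * ν + 2) * besselNormalized (ν + 1) s) (Icc 0 t) := by
    refine strictMonoOn_of_deriv_pos (convex_Icc 0 t) ((Real.continuous_rpow_const hexp.le).mul
      (continuous_besselNormalized _)).continuousOn fun s hs => ?_
    rw [interior_Icc] at hs
    rw [(hasDerivAt_rpow_mul_besselNormalized hν hs.1).deriv]
    exact mul_pos hexp (mul_pos (Real.rpow_pos_of_pos hs.1 _) (hpos s hs))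
  have hlt : 0 < t ^ (2 * ν + 2) * besselNormalized (ν + 1) t := by
    simpa only [Real.zero_rpow hexp.ne', zero_mul] using
      hmono (left_mem_Icc.2 ht.le) (right_mem_Icc.2 ht.le) ht
  exact pos_of_mul_pos_right hlt (by positivity)

-- Write `𝒥_ν` for the normalized function. If there were no zero, then `𝒥_ν`, `𝒥_{ν+1}`, `𝒥_{ν+2}`
-- and `𝒥_{ν+3}` would all be positive. But at `T ^ 2 = 4 (ν + 1) (ν + 2)` the recurrence gives
-- `𝒥_ν = 𝒥_{ν+1} - 𝒥_{ν+2}`, which is a negative multiple of `𝒥_{ν+3}`; this is the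
-- classical bound `j_{ν,1} ^ 2 < 4 (ν + 1) (ν + 2)`.
lemma exists_besselNormalized_eq_zero (hν : -1 < ν) :
    ∃ t : ℝ, 0 < t ∧ besselNormalized ν t = 0 := by
  by_contra! hne
  have h0 : ∀ t, 0 ≤ t → 0 < besselNormalized ν t := fun t ht =>
    besselNormalized_pos_of_ne_zero hν ht fun s hs => hne s hs.1
  have h1 : ∀ t, 0 ≤ t → 0 < besselNormalized (ν + 1) t := fun t ht =>
    besselNormalized_add_one_pos hν ht fun s hs => h0 s hs.1.le
  have h2 : ∀ t, 0 ≤ t → 0 < besselNormalized (ν + 1 + 1) t := fun t ht =>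
    besselNormalized_add_one_pos (by linarith) ht fun s hs => h1 s hs.1.le
  have hprod : 0 < 4 * (ν + 1) * (ν + 2) := mul_pos (by linarith) (by linarith)
  obtain ⟨T, hT, hTsq⟩ : ∃ T : ℝ, 0 ≤ T ∧ T ^ 2 = 4 * (ν + 1) * (ν + 2) :=
    ⟨√(4 * (ν + 1) * (ν + 2)), Real.sqrt_nonneg _, Real.sq_sqrt hprod.le⟩
  have h3 : 0 < besselNormalized (ν + 1 + 1 + 1) T :=
    besselNormalized_add_one_pos (by linarith) hT fun s hs => h2 s hs.1.le
  have hrec := besselNormalized_recurrence hν T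
  have hrec' := besselNormalized_recurrence (ν := ν + 1) (by linarith) T
  rw [hTsq, div_self hprod.ne', one_mul] at hrec
  rw [show ν + 1 + 2 = ν + 1 + 1 + 1 by ring, show ν + 1 + 1 = ν + 2 by ring] at hrec'
  rw [show ν + 1 + 1 = ν + 2 by ring] at h3
  have hcoeff : 0 < T ^ 2 / (4 * (ν + 2) * (ν + 2 + 1)) := by
    rw [hTsq]
    exact div_pos hprod (mul_pos (by linarith) (by linarith))
  linarith [h0 T hT, mul_pos hcoeff h3]

lemma besselFirstZero_pos (hν : -1 < ν) : 0 < besselFirstZero ν := by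
  obtain ⟨z, hz, hz0⟩ := exists_besselNormalized_eq_zero hν
  have hnear : ∀ᶠ s in 𝓝 (0 : ℝ), 0 < besselNormalized ν s :=
    (continuous_besselNormalized ν).continuousAt.eventually_const_lt
      ((besselNormalized_zero hν).symm ▸ one_pos)
  obtain ⟨δ, hδ, hδpos⟩ := Metric.eventually_nhds_iff.1 hnear
  refine hδ.trans_le (le_csInf ⟨z, hz, (besselJ_eq_zero_iff hν hz).2 hz0⟩ ?_)
  rintro s ⟨hs, hs0⟩
  by_contra! hlt
  exact (hδpos (by simpa [abs_of_pos hs] using hlt)).ne' ((besselJ_eq_zero_iff hν hs).1 hs0)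

lemma besselNormalized_pos (hν : -1 < ν) (ht : 0 ≤ t) (htz : t < besselFirstZero ν) :
    0 < besselNormalized ν t :=
  besselNormalized_pos_of_ne_zero hν ht fun _ hs hs0 =>
    (hs.2.trans_lt htz).not_ge
      (csInf_le ⟨0, fun _ hr => hr.1.le⟩ ⟨hs.1, (besselJ_eq_zero_iff hν hs.1).2 hs0⟩)

end BesselNormalized

section WeightedMean

lemma exists_forall_mem_Ioo_map_mem_Ioo {α β : Type*} [ConditionallyCompleteLinearOrder α]
    [TopologicalSpace α] [OrderTopology α] [LinearOrder β] [TopologicalSpace β]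
    [OrderClosedTopology β] {g : α → β} {a b : α} (hab : a ≤ b) (hg : ContinuousOn g (Icc a b))
    (hlt : g a < g b) : ∃ p q, a ≤ p ∧ p < q ∧ q ≤ b ∧ ∀ s ∈ Ioo p q, g s ∈ Ioo (g p) (g q) := by
  obtain ⟨p, ⟨hp, hpa⟩, hpmax⟩ : ∃ p, IsGreatest (Icc a b ∩ g ⁻¹' Iic (g a)) p :=
    (isCompact_Icc.of_isClosed_subset (hg.preimage_isClosed_of_isClosed isClosed_Icc isClosed_Iic)
      inter_subset_left).exists_isGreatest ⟨a, left_mem_Icc.2 hab, le_rfl⟩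
  have hsub : Icc p b ⊆ Icc a b := Icc_subset_Icc_left hp.1
  obtain ⟨q, ⟨hq, hqb⟩, hqmin⟩ : ∃ q, IsLeast (Icc p b ∩ g ⁻¹' Ici (g b)) q :=
    (isCompact_Icc.of_isClosed_subset ((hg.mono hsub).preimage_isClosed_of_isClosed isClosed_Icc
      isClosed_Ici) inter_subset_left).exists_isLeast ⟨b, right_mem_Icc.2 hp.2, le_rfl⟩
  have hpq : p < q := hq.1.lt_of_ne fun h => (hpa.trans_lt hlt).not_ge (h ▸ hqb)
  refine ⟨p, q, hp.1, hpq, hq.2, fun s hs => ⟨?_, ?_⟩⟩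
  · refine lt_of_not_ge fun hle => hs.1.not_ge (hpmax ⟨?_, hle.trans hpa⟩)
    exact ⟨hp.1.trans hs.1.le, hs.2.le.trans hq.2⟩
  · refine lt_of_not_ge fun hle => hs.2.not_ge (hqmin ⟨?_, hqb.trans hle⟩)
    exact ⟨hs.1.le, hs.2.le.trans hq.2⟩

lemma mul_integral_lt_integral_mul {g w : ℝ → ℝ} {a b c : ℝ} (hab : a < b)
    (hg : ContinuousOn g (Icc a b)) (hw : ContinuousOn w (Icc a b))
    (hwpos : ∀ s ∈ Ioo a b, 0 < w s) (hlt : ∀ s ∈ Ioo a b, c < g s) :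
    c * ∫ s in a..b, w s < ∫ s in a..b, w s * g s := by
  rw [← uIcc_of_le hab.le] at hg hw
  have hpos : 0 < ∫ s in a..b, w s * (g s - c) :=
    intervalIntegral.intervalIntegral_pos_of_pos_on
      (hw.mul (hg.sub continuousOn_const)).intervalIntegrable
      (fun s hs => mul_pos (hwpos s hs) (sub_pos.2 (hlt s hs))) hab
  simp only [mul_sub] at hpos
  rw [intervalIntegral.integral_sub (hw.fun_mul hg).intervalIntegrable
    (hw.fun_mul continuousOn_const).intervalIntegrable, intervalIntegral.integral_mul_const] at hpos
  linarith

lemma integral_mul_lt_mul_integral {g w : ℝ → ℝ} {a b c : ℝ} (hab : a < b)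
    (hg : ContinuousOn g (Icc a b)) (hw : ContinuousOn w (Icc a b))
    (hwpos : ∀ s ∈ Ioo a b, 0 < w s) (hlt : ∀ s ∈ Ioo a b, g s < c) :
    ∫ s in a..b, w s * g s < c * ∫ s in a..b, w s := by
  have h := mul_integral_lt_integral_mul hab hg.neg hw hwpos fun s hs => neg_lt_neg (hlt s hs)
  simpa only [Pi.neg_apply, mul_neg, neg_mul, intervalIntegral.integral_neg, neg_lt_neg_iff] using h

-- If `g a < g b`, then `[a, b]` contains an interval `[p, q]` on which `g` stays strictly between
-- `g p` and `g q`, and so does its weighted mean.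
lemma antitoneOn_of_weighted_mean_eq_endpoint {g w : ℝ → ℝ} {s : Set ℝ} (hs : s.OrdConnected)
    (hg : ContinuousOn g s) (hw : ContinuousOn w s) (hwpos : ∀ x ∈ s, 0 < w x)
    (hmean : ∀ a ∈ s, ∀ b ∈ s, a < b →
      ∫ x in a..b, w x * g x = g a * ∫ x in a..b, w x ∨
      ∫ x in a..b, w x * g x = g b * ∫ x in a..b, w x) : AntitoneOn g s := by
  intro a ha b hb hab
  by_contra! hlt
  obtain ⟨p, q, hap, hpq, hqb, hmem⟩ :=
    exists_forall_mem_Ioo_map_mem_Ioo hab (hg.mono (hs.out ha hb)) hlt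
  have hp : p ∈ s := hs.out ha hb ⟨hap, hpq.le.trans hqb⟩
  have hq : q ∈ s := hs.out ha hb ⟨hap.trans hpq.le, hqb⟩
  have hsub := hs.out hp hq
  have hpos : ∀ x ∈ Ioo p q, 0 < w x := fun x hx => hwpos x (hsub (Ioo_subset_Icc_self hx))
  rcases hmean p hp q hq hpq with h | h
  · exact (mul_integral_lt_integral_mul hpq (hg.mono hsub) (hw.mono hsub) hpos
      fun x hx => (hmem x hx).1).ne' h
  · exact (integral_mul_lt_mul_integral hpq (hg.mono hsub) (hw.mono hsub) hpos
      fun x hx => (hmem x hx).2).ne h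

lemma eq_of_weighted_mean_eq_endpoint {g w : ℝ → ℝ} {s : Set ℝ} (hs : s.OrdConnected)
    (hg : ContinuousOn g s) (hw : ContinuousOn w s) (hwpos : ∀ x ∈ s, 0 < w x)
    (hmean : ∀ a ∈ s, ∀ b ∈ s, a < b →
      ∫ x in a..b, w x * g x = g a * ∫ x in a..b, w x ∨
      ∫ x in a..b, w x * g x = g b * ∫ x in a..b, w x) :
    ∀ a ∈ s, ∀ b ∈ s, g a = g b := by
  have hanti := antitoneOn_of_weighted_mean_eq_endpoint hs hg hw hwpos hmean
  have hmono : AntitoneOn (-g) s := by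
    refine antitoneOn_of_weighted_mean_eq_endpoint hs hg.neg hw hwpos fun a ha b hb hab => ?_
    simpa only [Pi.neg_apply, mul_neg, neg_mul, intervalIntegral.integral_neg, neg_inj]
      using hmean a ha b hb hab
  intro a ha b hb
  rcases le_total a b with hab | hab
  · exact le_antisymm (neg_le_neg_iff.1 (hmono ha hb hab)) (hanti ha hb hab)
  · exact le_antisymm (hanti hb ha hab) (neg_le_neg_iff.1 (hmono hb ha hab))

end WeightedMean

section PolarCoordinates

variable {E F : Type*} [NormedAddCommGroup E] [NormedSpace ℝ E] [FiniteDimensional ℝ E]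
  [Nontrivial E] [MeasurableSpace E] [BorelSpace E] [NormedAddCommGroup F] [NormedSpace ℝ F]

lemma integral_eq_integral_Ioi_integral_toSphere (μ : Measure E) [μ.IsAddHaarMeasure] {f : E → F}
    (hf : Integrable f μ) :
    ∫ x, f x ∂μ = ∫ s in Ioi (0 : ℝ), s ^ (Module.finrank ℝ E - 1) •
      ∫ y : sphere (0 : E) 1, f (s • (y : E)) ∂μ.toSphere := by
  let G : sphere (0 : E) 1 × Ioi (0 : ℝ) → F := fun p => f ((p.2 : ℝ) • (p.1 : E))
  have hG : G ∘ homeomorphUnitSphereProd E = f ∘ ((↑) : ({0}ᶜ : Set E) → E) := by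
    ext x
    simp [G, smul_smul, norm_ne_zero_iff.2 x.2]
  have hmp := μ.measurePreserving_homeomorphUnitSphereProd
  have hemb := (homeomorphUnitSphereProd E).measurableEmbedding
  have hint : Integrable G (μ.toSphere.prod (.volumeIoiPow (Module.finrank ℝ E - 1))) := by
    rw [← hmp.integrable_comp_emb hemb, hG,
      ← integrableOn_iff_comap_subtypeVal (measurableSet_singleton _).compl]
    exact hf.integrableOn
  calc
    ∫ x, f x ∂μ = ∫ x : ({0}ᶜ : Set E), f x ∂(μ.comap (↑)) := by
      rw [integral_subtype_comap (measurableSet_singleton _).compl f, restrict_compl_singleton]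
    _ = ∫ p, G p ∂μ.toSphere.prod (.volumeIoiPow (Module.finrank ℝ E - 1)) := by
      rw [← hmp.integral_comp hemb]
      exact congrArg (fun g => integral _ g) hG.symm
    _ = ∫ s : Ioi (0 : ℝ), ∫ y, G (y, s) ∂μ.toSphere ∂.volumeIoiPow (Module.finrank ℝ E - 1) :=
      integral_prod_symm _ hint
    _ = ∫ s : Ioi (0 : ℝ), Real.toNNReal ((s : ℝ) ^ (Module.finrank ℝ E - 1)) •
          ∫ y, G (y, s) ∂μ.toSphere ∂(volume.comap (Subtype.val : Ioi (0 : ℝ) → ℝ)) := by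
      simp only [Measure.volumeIoiPow, ENNReal.ofReal]
      exact integral_withDensity_eq_integral_smul
        (measurable_subtype_coe.pow_const _).real_toNNReal _
    _ = ∫ s in Ioi (0 : ℝ), Real.toNNReal (s ^ (Module.finrank ℝ E - 1)) •
          ∫ y : sphere (0 : E) 1, f (s • (y : E)) ∂μ.toSphere :=
      integral_subtype_comap measurableSet_Ioi fun s : ℝ =>
        Real.toNNReal (s ^ (Module.finrank ℝ E - 1)) •
          ∫ y : sphere (0 : E) 1, f (s • (y : E)) ∂μ.toSphere
    _ = _ := setIntegral_congr_fun measurableSet_Ioi fun s hs => by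
      rw [NNReal.smul_def, Real.coe_toNNReal _ (pow_nonneg hs.out.le _)]

end PolarCoordinates

section SphericalMean

variable {m : ℕ}

local notation "ℝᵐ" => EuclideanSpace ℝ (Fin m)

/-- The area `ω_m` of the unit sphere of `ℝᵐ`. -/
noncomputable def sphereArea (m : ℕ) : ℝ :=
  (volume : Measure (EuclideanSpace ℝ (Fin m))).toSphere.real univ

lemma norm_smul_coe_sphere {E : Type*} [SeminormedAddCommGroup E] [NormedSpace ℝ E] {r : ℝ}
    (hr : 0 ≤ r) (y : sphere (0 : E) 1) : ‖r • (y : E)‖ = r := by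
  rw [norm_smul, Real.norm_of_nonneg hr, norm_eq_of_mem_sphere, mul_one]

lemma dist_self_add_smul_coe_sphere {E : Type*} [SeminormedAddCommGroup E] [NormedSpace ℝ E]
    {r : ℝ} (hr : 0 ≤ r) (x : E) (y : sphere (0 : E) 1) : dist x (x + r • (y : E)) = r := by
  rw [dist_self_add_right, norm_smul_coe_sphere hr]

lemma sphericalMean_mul_left_of_radial (k : ℝ → ℝ) (u : ℝᵐ → ℝ) (x : ℝᵐ) {r : ℝ} (hr : 0 ≤ r) :
    sphericalMean x r (fun y => k (dist x y) * u y) = k r * sphericalMean x r u := by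
  simp only [sphericalMean, dist_self_add_smul_coe_sphere hr, integral_const_mul]
  ring

lemma continuousOn_sphericalMean {u : ℝᵐ → ℝ} {x : ℝᵐ} {R : ℝ}
    (hu : ContinuousOn u (closedBall x R)) :
    ContinuousOn (fun r => sphericalMean x r u) (Icc 0 R) := by
  have hmaps : ∀ r ∈ Icc 0 R, ∀ y : sphere (0 : ℝᵐ) 1, x + r • (y : ℝᵐ) ∈ closedBall x R := by
    intro r hr y
    rw [mem_closedBall', dist_self_add_smul_coe_sphere hr.1]
    exact hr.2
  obtain ⟨C, hC⟩ := (isCompact_closedBall x R).exists_bound_of_continuousOn hu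
  refine continuousOn_const.mul (continuousOn_of_dominated (bound := fun _ => C) ?_ ?_
    (integrable_const _) ?_)
  · exact fun r hr => (hu.comp_continuous (by fun_prop) (hmaps r hr)).aestronglyMeasurable
  · exact fun r hr => .of_forall fun y => hC _ (hmaps r hr y)
  · exact .of_forall fun y => hu.comp (by fun_prop) fun r hr => hmaps r hr y

lemma sphericalMean_sub {u v : ℝᵐ → ℝ} {x : ℝᵐ} {r : ℝ} (hr : 0 ≤ r)
    (hu : ContinuousOn u (closedBall x r)) (hv : ContinuousOn v (closedBall x r)) :
    sphericalMean x r (fun y => u y - v y) = sphericalMean x r u - sphericalMean x r v := by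
  have hint : ∀ {f : ℝᵐ → ℝ}, ContinuousOn f (closedBall x r) →
      Integrable (fun y : sphere (0 : ℝᵐ) 1 => f (x + r • (y : ℝᵐ))) volume.toSphere :=
    fun hf => (hf.comp_continuous (by fun_prop) fun y => mem_closedBall'.2
      (dist_self_add_smul_coe_sphere hr x y).le).integrable_of_hasCompactSupport
        (.of_compactSpace _)
  simp only [sphericalMean, integral_sub (hint hu) (hint hv), mul_sub]

lemma isOpen_annulus (x : ℝᵐ) (a b : ℝ) : IsOpen (annulus x a b) :=
  (isOpen_Ioo (a := a) (b := b)).preimage (continuous_const.dist continuous_id)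

lemma annulus_subset_closedBall (x : ℝᵐ) (a b : ℝ) : annulus x a b ⊆ closedBall x b :=
  fun _ hy => mem_closedBall'.2 hy.2.le

variable [NeZero m]

lemma sphereArea_pos : 0 < sphereArea m := by
  refine ENNReal.toReal_pos (Measure.measure_univ_ne_zero.2 ?_) (measure_ne_top _ _)
  exact Measure.toSphere_ne_zero _

lemma sphereArea_mul_sphericalMean (u : ℝᵐ → ℝ) (x : ℝᵐ) (r : ℝ) :
    sphereArea m * sphericalMean x r u =
      ∫ y : sphere (0 : ℝᵐ) 1, u (x + r • (y : ℝᵐ)) ∂volume.toSphere :=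
  mul_inv_cancel_left₀ sphereArea_pos.ne' _

lemma sphericalMean_const (x : ℝᵐ) (r c : ℝ) : sphericalMean x r (fun _ => c) = c := by
  rw [sphericalMean, integral_const, smul_eq_mul]
  exact inv_mul_cancel_left₀ sphereArea_pos.ne' _

lemma sphericalMean_zero (x : ℝᵐ) (u : ℝᵐ → ℝ) : sphericalMean x 0 u = u x := by
  simpa only [sphericalMean, zero_smul, add_zero] using sphericalMean_const x 0 (u x)

lemma volume_real_ball (x : ℝᵐ) {r : ℝ} (hr : 0 ≤ r) :
    volume.real (ball x r) = sphereArea m / m * r ^ m := by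
  rw [← Measure.addHaar_real_closedBall_eq_addHaar_real_ball,
    Measure.addHaar_real_closedBall _ _ hr, sphereArea, Measure.toSphere_real_apply_univ,
    finrank_euclideanSpace_fin, mul_div_cancel_left₀ _ (NeZero.ne (m : ℝ)), mul_comm]

lemma volume_real_annulus_pos (x : ℝᵐ) {a b : ℝ} (ha : 0 ≤ a) (hab : a < b) :
    0 < volume.real (annulus x a b) := by
  obtain ⟨r, har, hrb⟩ := exists_between hab
  obtain ⟨v, hv⟩ := exists_norm_eq ℝᵐ (ha.trans har.le)
  have hmem : x + v ∈ annulus x a b := by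
    rw [annulus, mem_ofPred_eq, dist_self_add_right, hv]
    exact ⟨har, hrb⟩
  exact ENNReal.toReal_pos ((isOpen_annulus x a b).measure_pos _ ⟨_, hmem⟩).ne'
    ((measure_mono (annulus_subset_closedBall x a b)).trans_lt measure_closedBall_lt_top).ne

lemma integral_eq_integral_Ioi_sphericalMean {f : ℝᵐ → ℝ} (hf : Integrable f) (x : ℝᵐ) :
    ∫ y, f y = sphereArea m * ∫ s in Ioi (0 : ℝ), s ^ (m - 1) * sphericalMean x s f := by
  rw [← integral_add_left_eq_self f x,
    integral_eq_integral_Ioi_integral_toSphere volume (hf.comp_add_left x),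
    finrank_euclideanSpace_fin, ← integral_const_mul]
  simp only [← sphereArea_mul_sphericalMean, smul_eq_mul, mul_left_comm]

lemma setIntegral_annulus {u : ℝᵐ → ℝ} {x : ℝᵐ} {a b : ℝ} (ha : 0 ≤ a) (hab : a ≤ b)
    (hu : IntegrableOn u (annulus x a b)) :
    ∫ y in annulus x a b, u y =
      sphereArea m * ∫ s in a..b, s ^ (m - 1) * sphericalMean x s u := by
  have hind : (annulus x a b).indicator u =
      fun y => (Ioo a b).indicator (fun _ => 1) (dist x y) * u y := by
    ext y
    by_cases hy : y ∈ annulus x a b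
    · rw [indicator_of_mem hy, indicator_of_mem (show dist x y ∈ Ioo a b from hy), one_mul]
    · rw [indicator_of_notMem hy, indicator_of_notMem (show dist x y ∉ Ioo a b from hy), zero_mul]
  have hsub : Ioo a b ⊆ Ioi 0 := fun s hs => ha.trans_lt hs.1
  have hA := (isOpen_annulus x a b).measurableSet
  rw [← integral_indicator hA,
    integral_eq_integral_Ioi_sphericalMean (hu.integrable_indicator hA) x,
    intervalIntegral.integral_of_le hab, integral_Ioc_eq_integral_Ioo, ← inter_eq_right.2 hsub,
    ← setIntegral_indicator measurableSet_Ioo, hind]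
  congr 1
  refine setIntegral_congr_fun measurableSet_Ioi fun s hs => ?_
  by_cases h : s ∈ Ioo a b <;>
    simp only [sphericalMean_mul_left_of_radial _ u x (le_of_lt hs), h, indicator_of_mem,
      indicator_of_notMem, not_false_eq_true, one_mul, zero_mul, mul_zero]

end SphericalMean

section MeanValue

variable {m : ℕ} [NeZero m] {lam : ℝ}

lemma neg_one_lt_natCast_sub_two_div_two : -1 < ((m : ℝ) - 2) / 2 := by
  have : 0 < (m : ℝ) := Nat.cast_pos.2 (NeZero.pos m)
  linarith

lemma hasDerivAt_pow_mul_besselNormalized {t : ℝ} (ht : 0 < t) :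
    HasDerivAt (fun t => t ^ m * besselNormalized ((m : ℝ) / 2) t)
      (m * (t ^ (m - 1) * besselNormalized (((m : ℝ) - 2) / 2) t)) t := by
  have h := hasDerivAt_rpow_mul_besselNormalized (neg_one_lt_natCast_sub_two_div_two (m := m)) ht
  have hcast : ((m - 1 : ℕ) : ℝ) = (m : ℝ) - 1 := by rw [Nat.cast_pred (NeZero.pos m)]
  rw [show 2 * (((m : ℝ) - 2) / 2) + 2 = m by ring,
    show 2 * (((m : ℝ) - 2) / 2) + 1 = (m - 1 : ℕ) by rw [hcast]; ring,
    show ((m : ℝ) - 2) / 2 + 1 = m / 2 by ring] at h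
  simpa only [Real.rpow_natCast] using h

lemma integral_pow_mul_besselNormalized (hlam : 0 < lam) {a b : ℝ} (ha : 0 < a) (hab : a ≤ b) :
    m * ∫ s in a..b, s ^ (m - 1) * besselNormalized (((m : ℝ) - 2) / 2) (lam * s) =
      b ^ m * besselNormalized ((m : ℝ) / 2) (lam * b) -
        a ^ m * besselNormalized ((m : ℝ) / 2) (lam * a) := by
  have hc := continuous_besselNormalized (((m : ℝ) - 2) / 2)
  rw [← intervalIntegral.integral_const_mul]
  refine intervalIntegral.integral_eq_sub_of_hasDerivAt
    (f := fun s => s ^ m * besselNormalized ((m : ℝ) / 2) (lam * s)) (fun s hs => ?_)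
    (Continuous.intervalIntegrable (by fun_prop) _ _)
  rw [uIcc_of_le hab] at hs
  have h := ((hasDerivAt_pow_mul_besselNormalized (m := m)
    (mul_pos hlam (ha.trans_le hs.1))).comp s (hasDerivAt_const_mul lam)).const_mul (lam ^ m)⁻¹
  convert! h using 1
  · ext s
    simp only [Function.comp, mul_pow]
    field_simp
  · rw [mul_pow, ← mul_pow_sub_one (NeZero.ne m) lam]
    field_simp

variable {x : EuclideanSpace ℝ (Fin m)} {u : EuclideanSpace ℝ (Fin m) → ℝ}

lemma AnnularIdentity.integral_eq (hlam : 0 < lam) {r₁ r₂ r : ℝ} (h₁ : 0 < r₁) (h₁₂ : r₁ < r₂)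
    (hr : 0 < r) (hu : ContinuousOn u (closedBall x r₂)) (h : AnnularIdentity lam u x r₁ r₂ r) :
    ∫ s in r₁..r₂, s ^ (m - 1) * sphericalMean x s u =
      sphericalMean x r u / besselNormalized (((m : ℝ) - 2) / 2) (lam * r) *
        ∫ s in r₁..r₂, s ^ (m - 1) * besselNormalized (((m : ℝ) - 2) / 2) (lam * s) := by
  have h₂ : 0 < r₂ := h₁.trans h₁₂
  have hm : (m : ℝ) ≠ 0 := NeZero.ne _
  have hω := (sphereArea_pos (m := m)).ne'
  have hV := (volume_real_annulus_pos x h₁.le h₁₂).ne'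
  have hint : IntegrableOn u (annulus x r₁ r₂) :=
    (hu.integrableOn_compact (isCompact_closedBall x r₂)).mono_set
      (annulus_subset_closedBall x r₁ r₂)
  rw [AnnularIdentity, volumeMean, setIntegral_annulus h₁.le h₁₂.le hint,
    aBall_eq_besselNormalized m (mul_pos hlam h₁), aBall_eq_besselNormalized m (mul_pos hlam h₂),
    aSphere_eq_besselNormalized m (mul_pos hlam hr), volume_real_ball x h₁.le,
    volume_real_ball x h₂.le] at h
  have hcoef : besselNormalized ((m : ℝ) / 2) (lam * r₂) * (sphereArea m / m * r₂ ^ m) -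
      besselNormalized ((m : ℝ) / 2) (lam * r₁) * (sphereArea m / m * r₁ ^ m) = sphereArea m *
        ∫ s in r₁..r₂, s ^ (m - 1) * besselNormalized (((m : ℝ) - 2) / 2) (lam * s) := by
    have := integral_pow_mul_besselNormalized (m := m) hlam h₁ h₁₂.le
    field_simp
    linear_combination -this
  rw [hcoef, div_mul_eq_div_div, div_eq_inv_mul _ (volume.real _), mul_assoc] at h
  refine mul_left_cancel₀ hω ((mul_left_cancel₀ (inv_ne_zero hV) h).trans ?_)
  ring

end MeanValue

section MeanValueFormula

variable {m : ℕ} [NeZero m] {lam R : ℝ} {x : EuclideanSpace ℝ (Fin m)}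
  {u : EuclideanSpace ℝ (Fin m) → ℝ}

lemma besselNormalized_mul_pos {ν s : ℝ} (hν : -1 < ν) (hlam : 0 < lam) (hs : 0 ≤ s)
    (hsj : s < besselFirstZero ν / lam) : 0 < besselNormalized ν (lam * s) :=
  besselNormalized_pos hν (mul_nonneg hlam.le hs) ((lt_div_iff₀' hlam).1 hsj)

lemma continuousOn_sphericalMean_div (hlam : 0 < lam)
    (hR : R < besselFirstZero (((m : ℝ) - 2) / 2) / lam) (hu : ContinuousOn u (closedBall x R)) :
    ContinuousOn (fun s => sphericalMean x s u / besselNormalized (((m : ℝ) - 2) / 2) (lam * s))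
      (Icc 0 R) := by
  have hc := continuous_besselNormalized (((m : ℝ) - 2) / 2)
  refine (continuousOn_sphericalMean hu).div (by fun_prop) fun s hs => ?_
  exact (besselNormalized_mul_pos neg_one_lt_natCast_sub_two_div_two hlam hs.1
    (hs.2.trans_lt hR)).ne'

lemma integral_sphericalMean_eq_endpoint (hlam : 0 < lam) {a b : ℝ} (ha : 0 < a) (hab : a < b)
    (hb : b < besselFirstZero (((m : ℝ) - 2) / 2) / lam) (hu : ContinuousOn u (closedBall x b))
    (h : (∀ r ∈ Ioo a b, AnnularIdentity lam u x a b r) ∨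
      AnnularIdentity lam u x a b a ∨ AnnularIdentity lam u x a b b) :
    (∫ s in a..b, s ^ (m - 1) * sphericalMean x s u =
        sphericalMean x a u / besselNormalized (((m : ℝ) - 2) / 2) (lam * a) *
          ∫ s in a..b, s ^ (m - 1) * besselNormalized (((m : ℝ) - 2) / 2) (lam * s)) ∨
      ∫ s in a..b, s ^ (m - 1) * sphericalMean x s u =
        sphericalMean x b u / besselNormalized (((m : ℝ) - 2) / 2) (lam * b) *
          ∫ s in a..b, s ^ (m - 1) * besselNormalized (((m : ℝ) - 2) / 2) (lam * s) := by
  rcases h with hall | hleft | hright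
  · have hcont := (continuousOn_sphericalMean_div hlam hb hu).mono (Icc_subset_Icc_left ha.le)
    have hIoo : EqOn (fun _ => ∫ s in a..b, s ^ (m - 1) * sphericalMean x s u)
        (fun r => sphericalMean x r u / besselNormalized (((m : ℝ) - 2) / 2) (lam * r) *
          ∫ s in a..b, s ^ (m - 1) * besselNormalized (((m : ℝ) - 2) / 2) (lam * s)) (Ioo a b) :=
      fun r hr => (hall r hr).integral_eq hlam ha hab (ha.trans hr.1) hu
    exact .inl (hIoo.of_subset_closure continuousOn_const (hcont.mul continuousOn_const)
      Ioo_subset_Icc_self (closure_Ioo hab.ne).ge (left_mem_Icc.2 hab.le))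
  · exact .inl (hleft.integral_eq hlam ha hab ha hu)
  · exact .inr (hright.integral_eq hlam ha hab (ha.trans hab) hu)

lemma sphericalMean_div_eq_of_annularIdentity (hlam : 0 < lam)
    (hR : R < besselFirstZero (((m : ℝ) - 2) / 2) / lam) (hu : ContinuousOn u (closedBall x R))
    (h : ∀ r₁ r₂ : ℝ, 0 < r₁ → r₁ < r₂ → r₂ ≤ R →
      (∀ r ∈ Ioo r₁ r₂, AnnularIdentity lam u x r₁ r₂ r) ∨
        AnnularIdentity lam u x r₁ r₂ r₁ ∨ AnnularIdentity lam u x r₁ r₂ r₂) :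
    ∀ a ∈ Ioc 0 R, ∀ b ∈ Ioc 0 R,
      sphericalMean x a u / besselNormalized (((m : ℝ) - 2) / 2) (lam * a) =
        sphericalMean x b u / besselNormalized (((m : ℝ) - 2) / 2) (lam * b) := by
  have hc := continuous_besselNormalized (((m : ℝ) - 2) / 2)
  have hpos : ∀ s ∈ Ioc 0 R, 0 < besselNormalized (((m : ℝ) - 2) / 2) (lam * s) := fun s hs =>
    besselNormalized_mul_pos neg_one_lt_natCast_sub_two_div_two hlam hs.1.le (hs.2.trans_lt hR)
  refine eq_of_weighted_mean_eq_endpoint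
    (w := fun s => s ^ (m - 1) * besselNormalized (((m : ℝ) - 2) / 2) (lam * s)) ordConnected_Ioc
    ((continuousOn_sphericalMean_div hlam hR hu).mono Ioc_subset_Icc_self) (by fun_prop)
    (fun s hs => mul_pos (pow_pos hs.1 _) (hpos s hs)) fun a ha b hb hab => ?_
  have hcancel : ∫ s in a..b, s ^ (m - 1) * besselNormalized (((m : ℝ) - 2) / 2) (lam * s) *
      (sphericalMean x s u / besselNormalized (((m : ℝ) - 2) / 2) (lam * s)) =
        ∫ s in a..b, s ^ (m - 1) * sphericalMean x s u := by
    refine intervalIntegral.integral_congr fun s hs => ?_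
    rw [uIcc_of_le hab.le] at hs
    have := (hpos s ⟨ha.1.trans_le hs.1, hs.2.trans hb.2⟩).ne'
    field_simp
  rw [hcancel]
  exact integral_sphericalMean_eq_endpoint hlam ha.1 hab (hb.2.trans_lt hR)
    (hu.mono (closedBall_subset_closedBall hb.2)) (h a b ha.1 hab hb.2)

theorem sphericalMean_eq_of_annularIdentity (hlam : 0 < lam) (hR0 : 0 < R)
    (hR : R < besselFirstZero (((m : ℝ) - 2) / 2) / lam) (hu : ContinuousOn u (closedBall x R))
    (h : ∀ r₁ r₂ : ℝ, 0 < r₁ → r₁ < r₂ → r₂ ≤ R →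
      (∀ r ∈ Ioo r₁ r₂, AnnularIdentity lam u x r₁ r₂ r) ∨
        AnnularIdentity lam u x r₁ r₂ r₁ ∨ AnnularIdentity lam u x r₁ r₂ r₂) :
    sphericalMean x R u = u x * besselNormalized (((m : ℝ) - 2) / 2) (lam * R) := by
  have hν := neg_one_lt_natCast_sub_two_div_two (m := m)
  have hIoc : EqOn
      (fun s => sphericalMean x s u / besselNormalized (((m : ℝ) - 2) / 2) (lam * s))
      (fun _ => sphericalMean x R u / besselNormalized (((m : ℝ) - 2) / 2) (lam * R)) (Ioc 0 R) :=
    fun s hs => sphericalMean_div_eq_of_annularIdentity hlam hR hu h s hs R (right_mem_Ioc.2 hR0)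
  have hzero := hIoc.of_subset_closure (continuousOn_sphericalMean_div hlam hR hu)
    continuousOn_const Ioc_subset_Icc_self (closure_Ioc hR0.ne).ge (left_mem_Icc.2 hR0.le)
  simp only [sphericalMean_zero, mul_zero, besselNormalized_zero hν, div_one] at hzero
  rw [hzero, div_mul_cancel₀ _ (besselNormalized_mul_pos hν hlam hR0.le hR).ne']

end MeanValueFormula

section Smoothing

variable {m : ℕ}

local notation "ℝᵐ" => EuclideanSpace ℝ (Fin m)

/-- A smooth function of `s ^ 2`, positive for `|s| < R` and zero for `|s| ≥ R`: the profile of the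
radial mollifiers. Depending on `s` through `s ^ 2` keeps the mollifier smooth at the origin. -/
noncomputable def radialBump (R s : ℝ) : ℝ :=
  Real.smoothTransition (R ^ 2 - s ^ 2)

lemma continuous_radialBump (R : ℝ) : Continuous (radialBump R) :=
  Real.smoothTransition.continuous.comp (by fun_prop)

lemma radialBump_pos {R s : ℝ} (hs : 0 ≤ s) (hsR : s < R) : 0 < radialBump R s :=
  Real.smoothTransition.pos_of_pos (sub_pos.2 (pow_lt_pow_left₀ hsR hs two_ne_zero))

lemma radialBump_of_le {R s : ℝ} (hR : 0 ≤ R) (hs : R ≤ s) : radialBump R s = 0 :=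
  Real.smoothTransition.zero_of_nonpos (sub_nonpos.2 (pow_le_pow_left₀ hR hs 2))

lemma contDiff_radialBump_norm {E : Type*} [NormedAddCommGroup E] [InnerProductSpace ℝ E]
    {n : ℕ∞} (R : ℝ) : ContDiff ℝ n fun y : E => radialBump R ‖y‖ :=
  Real.smoothTransition.contDiff.comp (contDiff_const.sub (contDiff_norm_sq ℝ))

lemma hasCompactSupport_radialBump_norm {E : Type*} [NormedAddCommGroup E] [ProperSpace E]
    {R : ℝ} (hR : 0 ≤ R) : HasCompactSupport fun y : E => radialBump R ‖y‖ :=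
  .intro (isCompact_closedBall 0 R) fun _ hy => radialBump_of_le hR
    (not_le.1 fun h => hy (mem_closedBall_zero_iff.2 h)).le

lemma contDiff_integral_radialBump_mul {n : ℕ∞} {R : ℝ} (hR : 0 ≤ R) {v : ℝᵐ → ℝ}
    (hv : LocallyIntegrable v) : ContDiff ℝ n fun x => ∫ y, radialBump R (dist x y) * v y := by
  have h := (hasCompactSupport_radialBump_norm hR).contDiff_convolution_left (n := n)
    (ContinuousLinearMap.lsmul ℝ ℝ) (contDiff_radialBump_norm R) hv
  convert! h using 1
  ext x
  simp only [convolution_eq_swap, ContinuousLinearMap.lsmul_apply, smul_eq_mul, dist_eq_norm]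

lemma integral_radialBump_mul_indicator {R : ℝ} (hR : 0 ≤ R) {x : ℝᵐ} {s : Set ℝᵐ}
    (hs : closedBall x R ⊆ s) (u : ℝᵐ → ℝ) :
    ∫ y, radialBump R (dist x y) * s.indicator u y = ∫ y, radialBump R (dist x y) * u y := by
  congr 1 with y
  by_cases hy : y ∈ closedBall x R
  · rw [indicator_of_mem (hs hy)]
  · rw [radialBump_of_le hR (not_le.1 fun h => hy (mem_closedBall'.2 h)).le, zero_mul, zero_mul]

variable [NeZero m]

lemma integral_radial_mul {k : ℝ → ℝ} (hk : Continuous k) {R : ℝ} (hR : 0 ≤ R)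
    (hk0 : ∀ s, R ≤ s → k s = 0) {u : ℝᵐ → ℝ} {x : ℝᵐ} (hu : ContinuousOn u (closedBall x R)) :
    ∫ y, k (dist x y) * u y =
      sphereArea m * ∫ s in 0..R, s ^ (m - 1) * (k s * sphericalMean x s u) := by
  have hint : Integrable fun y => k (dist x y) * u y := by
    have hcont : ContinuousOn (fun y => k (dist x y) * u y) (closedBall x R) :=
      (Continuous.continuousOn (by fun_prop)).mul hu
    have hon := hcont.integrableOn_compact (μ := volume) (isCompact_closedBall x R)
    refine hon.integrable_of_forall_notMem_eq_zero fun y hy => ?_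
    rw [hk0 _ (not_le.1 fun h => hy (mem_closedBall'.2 h)).le, zero_mul]
  rw [integral_eq_integral_Ioi_sphericalMean hint x, intervalIntegral.integral_of_le hR]
  congr 1
  rw [setIntegral_eq_of_subset_of_forall_sdiff_eq_zero measurableSet_Ioi Ioc_subset_Ioi_self]
  · refine setIntegral_congr_fun measurableSet_Ioc fun s hs => ?_
    rw [sphericalMean_mul_left_of_radial k u x hs.1.le]
  · rintro s ⟨hs0, hsR⟩
    have hRs : R ≤ s := (not_le.1 fun h => hsR ⟨hs0, h⟩).le
    rw [sphericalMean_mul_left_of_radial k u x (le_of_lt hs0), hk0 s hRs, zero_mul, mul_zero]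

lemma integral_radial_mul_of_sphericalMean_eq {k A : ℝ → ℝ} (hk : Continuous k) {R : ℝ}
    (hR : 0 ≤ R) (hk0 : ∀ s, R ≤ s → k s = 0) {u : ℝᵐ → ℝ} {x : ℝᵐ}
    (hu : ContinuousOn u (closedBall x R))
    (hmean : ∀ s ∈ Ioc 0 R, sphericalMean x s u = u x * A s) :
    ∫ y, k (dist x y) * u y = (sphereArea m * ∫ s in 0..R, s ^ (m - 1) * (k s * A s)) * u x := by
  rw [integral_radial_mul hk hR hk0 hu, mul_assoc, ← intervalIntegral.integral_mul_const]
  congr 1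
  refine intervalIntegral.integral_congr_ae (.of_forall fun s hs => ?_)
  rw [uIoc_of_le hR] at hs
  rw [hmean s hs]
  ring

lemma sphereArea_mul_integral_radialBump_pos {A : ℝ → ℝ} (hA : Continuous A) {R : ℝ} (hR : 0 < R)
    (hApos : ∀ s ∈ Ioo 0 R, 0 < A s) :
    0 < sphereArea m * ∫ s in 0..R, s ^ (m - 1) * (radialBump R s * A s) := by
  have hbump := continuous_radialBump R
  refine mul_pos sphereArea_pos (intervalIntegral.intervalIntegral_pos_of_pos_on
    (Continuous.intervalIntegrable (by fun_prop) _ _) (fun s hs => ?_) hR)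
  exact mul_pos (pow_pos hs.1 _) (mul_pos (radialBump_pos hs.1.le hs.2) (hApos s hs))

theorem contDiffAt_of_sphericalMean_eq {n : ℕ∞} {D : Set ℝᵐ} (hD : IsOpen D) {u : ℝᵐ → ℝ}
    (hu : ContinuousOn u D) {A : ℝ → ℝ} (hA : Continuous A) {ρ : ℝ} (hρ : 0 < ρ)
    (hApos : ∀ r ∈ Ioo 0 ρ, 0 < A r)
    (hmean : ∀ x, ∀ r ∈ Ioo 0 ρ, closedBall x r ⊆ D → sphericalMean x r u = u x * A r)
    {x₀ : ℝᵐ} (hx₀ : x₀ ∈ D) : ContDiffAt ℝ n u x₀ := by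
  obtain ⟨δ, hδ, hδD⟩ := Metric.isOpen_iff.1 hD x₀ hx₀
  obtain ⟨R, hR, hRmin⟩ := exists_between (lt_min (half_pos hδ) hρ)
  have hRρ : R < ρ := hRmin.trans_le (min_le_right _ _)
  have hBD : closedBall x₀ (2 * R) ⊆ D :=
    (closedBall_subset_ball (by linarith [hRmin.trans_le (min_le_left _ _)])).trans hδD
  let c := sphereArea m * ∫ s in 0..R, s ^ (m - 1) * (radialBump R s * A s)
  have hc : 0 < c := sphereArea_mul_integral_radialBump_pos hA hR fun s hs =>
    hApos s ⟨hs.1, hs.2.trans hRρ⟩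
  have hvint : Integrable ((closedBall x₀ (2 * R)).indicator u) := IntegrableOn.integrable_indicator
    ((hu.mono hBD).integrableOn_compact (isCompact_closedBall _ _)) measurableSet_closedBall
  have hmollify : ∀ x ∈ ball x₀ R,
      ∫ y, radialBump R (dist x y) * (closedBall x₀ (2 * R)).indicator u y = c * u x := by
    intro x hx
    have hsub : closedBall x R ⊆ closedBall x₀ (2 * R) :=
      closedBall_subset_closedBall' (by linarith [mem_ball.1 hx])
    exact (integral_radialBump_mul_indicator hR.le hsub u).trans <|
      integral_radial_mul_of_sphericalMean_eq (continuous_radialBump R) hR.le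
        (fun s => radialBump_of_le hR.le) (hu.mono (hsub.trans hBD)) fun s hs =>
          hmean x s ⟨hs.1, hs.2.trans_lt hRρ⟩
            ((closedBall_subset_closedBall hs.2).trans (hsub.trans hBD))
  refine ((contDiff_integral_radialBump_mul hR.le hvint.locallyIntegrable).contDiffAt.const_smul
    c⁻¹).congr_of_eventuallyEq ?_
  filter_upwards [ball_mem_nhds x₀ hR] with x hx
  rw [hmollify x hx, smul_eq_mul, inv_mul_cancel_left₀ hc.ne']

end Smoothing

section Taylor

variable {E F : Type*} [NormedAddCommGroup E] [NormedSpace ℝ E] [NormedAddCommGroup F]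
  [NormedSpace ℝ F] {f : E → F} {x : E}

lemma hasFDerivAt_clm_apply_sub_self {B : E →L[ℝ] E →L[ℝ] F} (hB : ∀ v w, B v w = B w v)
    (x y : E) :
    HasFDerivAt (fun y => (1 / 2 : ℝ) • B (y - x) (y - x)) (B (y - x)) y := by
  have hid := (hasFDerivAt_id (𝕜 := ℝ) y).sub_const x
  convert! ((B.hasFDerivAt.comp y hid).clm_apply hid).const_smul (1 / 2 : ℝ) using 1
  ext v
  simp [hB v, ← two_smul ℝ]

theorem isLittleO_sub_taylor_two (hf : ContDiffAt ℝ 2 f x) :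
    (fun y => f y - f x - (fderiv ℝ f x (y - x) +
      (1 / 2 : ℝ) • fderiv ℝ (fderiv ℝ f) x (y - x) (y - x))) =o[𝓝 x] fun y => ‖y - x‖ ^ 2 := by
  have hdiff : ∀ᶠ y in 𝓝 x, DifferentiableAt ℝ f y :=
    (hf.eventually (by simp)).mono fun y hy => hy.differentiableAt two_ne_zero
  obtain ⟨δ, hδ, hball⟩ := Metric.eventually_nhds_iff_ball.1 hdiff
  have hsecond : DifferentiableAt ℝ (fderiv ℝ f) x :=
    (hf.fderiv_right (m := 1) (by norm_num)).differentiableAt one_ne_zero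
  have hsymm := hf.isSymmSndFDerivAt (by simp)
  have hderiv : ∀ y ∈ ball x δ, HasFDerivWithinAt (fun y => f y - (fderiv ℝ f x (y - x) +
      (1 / 2 : ℝ) • fderiv ℝ (fderiv ℝ f) x (y - x) (y - x)))
      (fderiv ℝ f y - (fderiv ℝ f x + fderiv ℝ (fderiv ℝ f) x (y - x))) (ball x δ) y :=
    fun y hy => ((hball y hy).hasFDerivAt.sub
      (((fderiv ℝ f x).hasFDerivAt.comp y ((hasFDerivAt_id y).sub_const x)).add
        (hasFDerivAt_clm_apply_sub_self hsymm x y))).hasFDerivWithinAt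
  have hlittleO := (convex_ball x δ).isLittleO_pow_succ (n := 1) (mem_ball_self hδ) hderiv <| by
    rw [nhdsWithin_eq_nhds.2 (ball_mem_nhds x hδ)]
    simpa only [pow_one, sub_sub, Asymptotics.isLittleO_norm_right] using
      hsecond.hasFDerivAt.isLittleO
  rw [nhdsWithin_eq_nhds.2 (ball_mem_nhds x hδ)] at hlittleO
  refine hlittleO.congr_left fun y => ?_
  simp only [sub_self, map_zero, smul_zero, add_zero, sub_zero]
  abel

end Taylor

section SphereMoments

open Module (finrank)
open scoped Pointwise

variable {E : Type*} [NormedAddCommGroup E] [InnerProductSpace ℝ E] [FiniteDimensional ℝ E]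
  [MeasurableSpace E] [BorelSpace E]

lemma measurePreserving_subtype_sphere (L : E ≃ₗᵢ[ℝ] E)
    (hL : ∀ y : E, y ∈ sphere 0 1 ↔ L.toHomeomorph y ∈ sphere 0 1) :
    MeasurePreserving (L.toHomeomorph.subtype hL) (volume : Measure E).toSphere
      (volume : Measure E).toSphere := by
  refine ⟨(L.toHomeomorph.subtype hL).measurable, Measure.ext fun s hs => ?_⟩
  have hcone : Ioo (0 : ℝ) 1 • ((↑) '' (L.toHomeomorph.subtype hL ⁻¹' s) : Set E) =
      L ⁻¹' (Ioo (0 : ℝ) 1 • ((↑) '' s)) := by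
    ext z
    constructor
    · rintro ⟨r, hr, _, ⟨y, hy, rfl⟩, rfl⟩
      exact ⟨r, hr, L y, ⟨_, hy, rfl⟩, (L.map_smul r y).symm⟩
    · rintro ⟨r, hr, _, ⟨w, hw, rfl⟩, hz⟩
      refine ⟨r, hr, L.symm w, ⟨(L.toHomeomorph.subtype hL).symm w, ?_, rfl⟩, ?_⟩
      · rwa [mem_preimage, Homeomorph.apply_symm_apply]
      · exact L.injective (by simpa using hz)
  rw [Measure.map_apply (L.toHomeomorph.subtype hL).measurable hs, Measure.toSphere_apply' _ hs,
    Measure.toSphere_apply' _ ((L.toHomeomorph.subtype hL).measurable hs), hcone,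
    L.measurePreserving.measure_preimage_emb L.toHomeomorph.measurableEmbedding]

lemma integral_toSphere_comp_linearIsometryEquiv {F : Type*} [NormedAddCommGroup F]
    [NormedSpace ℝ F] (L : E ≃ₗᵢ[ℝ] E) (f : E → F) :
    ∫ y : sphere (0 : E) 1, f (L y) ∂(volume : Measure E).toSphere =
      ∫ y : sphere (0 : E) 1, f y ∂(volume : Measure E).toSphere :=
  (measurePreserving_subtype_sphere L fun y => by simp).integral_comp
    (Homeomorph.measurableEmbedding _) fun y => f y

lemma integral_toSphere_clm (ℓ : E →L[ℝ] ℝ) :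
    ∫ y : sphere (0 : E) 1, ℓ y ∂(volume : Measure E).toSphere = 0 := by
  have h := integral_toSphere_comp_linearIsometryEquiv (LinearIsometryEquiv.neg ℝ) ℓ
  simp only [LinearIsometryEquiv.coe_neg, map_neg, integral_neg] at h
  linarith

lemma integral_toSphere_inner_map_mul_inner_map (L : E ≃ₗᵢ[ℝ] E) (v w : E) :
    ∫ y : sphere (0 : E) 1, ⟪L v, y⟫_ℝ * ⟪L w, y⟫_ℝ ∂(volume : Measure E).toSphere =
      ∫ y : sphere (0 : E) 1, ⟪v, y⟫_ℝ * ⟪w, y⟫_ℝ ∂(volume : Measure E).toSphere := by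
  simpa only [L.inner_map_map] using
    (integral_toSphere_comp_linearIsometryEquiv L fun y => ⟪L v, y⟫_ℝ * ⟪L w, y⟫_ℝ).symm

lemma integral_toSphere_inner_mul_inner_of_orthogonal {v w : E} (hvw : ⟪v, w⟫_ℝ = 0) :
    ∫ y : sphere (0 : E) 1, ⟪v, y⟫_ℝ * ⟪w, y⟫_ℝ ∂(volume : Measure E).toSphere = 0 := by
  have hw : w ∈ (ℝ ∙ v)ᗮ := Submodule.mem_orthogonal_singleton_iff_inner_right.2 hvw
  have h := integral_toSphere_inner_map_mul_inner_map (ℝ ∙ v)ᗮ.reflection v w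
  rw [Submodule.reflection_orthogonalComplement_singleton_eq_neg,
    Submodule.reflection_mem_subspace_eq_self hw] at h
  simp only [inner_neg_left, neg_mul, integral_neg] at h
  linarith

lemma integral_toSphere_inner_sq_congr {v w : E} (hvw : ‖v‖ = ‖w‖) :
    ∫ y : sphere (0 : E) 1, ⟪v, y⟫_ℝ ^ 2 ∂(volume : Measure E).toSphere =
      ∫ y : sphere (0 : E) 1, ⟪w, y⟫_ℝ ^ 2 ∂(volume : Measure E).toSphere := by
  have h := integral_toSphere_inner_map_mul_inner_map (ℝ ∙ (v - w))ᗮ.reflection v v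
  simp only [Submodule.reflection_sub hvw, ← sq] at h
  exact h.symm

variable {ι : Type*} [Fintype ι] (b : OrthonormalBasis ι ℝ E)

lemma finrank_mul_integral_toSphere_inner_sq (i : ι) :
    finrank ℝ E * ∫ y : sphere (0 : E) 1, ⟪b i, y⟫_ℝ ^ 2 ∂(volume : Measure E).toSphere =
      (volume : Measure E).toSphere.real univ := by
  have hint : ∀ j, Integrable (fun y : sphere (0 : E) 1 => ⟪b j, y⟫_ℝ ^ 2)
      (volume : Measure E).toSphere := fun j =>
    Continuous.integrable_of_hasCompactSupport (by fun_prop) (.of_compactSpace _)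
  calc _ = ∑ j, ∫ y : sphere (0 : E) 1, ⟪b j, y⟫_ℝ ^ 2 ∂(volume : Measure E).toSphere := by
        rw [Finset.sum_congr rfl fun j _ => integral_toSphere_inner_sq_congr
          ((b.norm_eq_one j).trans (b.norm_eq_one i).symm), Finset.sum_const, Finset.card_univ,
          nsmul_eq_mul, Module.finrank_eq_card_basis b.toBasis]
    _ = ∫ y : sphere (0 : E) 1, ‖(y : E)‖ ^ 2 ∂(volume : Measure E).toSphere := by
        rw [← integral_finsetSum _ fun j _ => hint j]
        simp only [b.sum_sq_inner_right]
    _ = _ := by simp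

theorem finrank_mul_integral_toSphere_bilinear (B : E →L[ℝ] E →L[ℝ] ℝ) :
    finrank ℝ E * ∫ y : sphere (0 : E) 1, B y y ∂(volume : Measure E).toSphere =
      (∑ i, B (b i) (b i)) * (volume : Measure E).toSphere.real univ := by
  have hexpand : ∀ y : E, B y y = ∑ i, ∑ j, B (b i) (b j) * (⟪b i, y⟫_ℝ * ⟪b j, y⟫_ℝ) := by
    intro y
    conv_lhs => rw [← b.sum_repr' y]
    simp only [map_sum, sum_apply, map_smul, smul_apply, smul_eq_mul, Finset.mul_sum]
    rw [Finset.sum_comm]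
    exact Finset.sum_congr rfl fun i _ => Finset.sum_congr rfl fun j _ => by ring
  have hint : ∀ i j, Integrable
      (fun y : sphere (0 : E) 1 => B (b i) (b j) * (⟪b i, y⟫_ℝ * ⟪b j, y⟫_ℝ))
      (volume : Measure E).toSphere := fun i j =>
    Continuous.integrable_of_hasCompactSupport (by fun_prop) (.of_compactSpace _)
  rw [integral_congr_ae (.of_forall fun y : sphere (0 : E) 1 => hexpand y),
    integral_finsetSum _ fun i _ => integrable_finsetSum _ fun j _ => hint i j,
    Finset.mul_sum, Finset.sum_mul]
  refine Finset.sum_congr rfl fun i _ => ?_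
  rw [integral_finsetSum _ fun j _ => hint i j, Finset.sum_eq_single i]
  · simp only [integral_const_mul, ← sq]
    rw [mul_left_comm, finrank_mul_integral_toSphere_inner_sq]
  · intro j _ hji
    rw [integral_const_mul, integral_toSphere_inner_mul_inner_of_orthogonal
      (b.inner_eq_zero hji.symm), mul_zero]
  · exact fun hi => (hi (Finset.mem_univ i)).elim

end SphereMoments

section Laplacian

open Asymptotics

lemma laplacian_eq_sum_fderiv {E F ι : Type*} [NormedAddCommGroup E] [InnerProductSpace ℝ E]
    [FiniteDimensional ℝ E] [NormedAddCommGroup F] [NormedSpace ℝ F] [Fintype ι]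
    (b : OrthonormalBasis ι ℝ E) (f : E → F) (x : E) :
    Laplacian.laplacian f x = ∑ i, fderiv ℝ (fderiv ℝ f) x (b i) (b i) := by
  rw [InnerProductSpace.laplacian_eq_iteratedFDeriv_orthonormalBasis f b]
  simp only [iteratedFDeriv_two_apply, Matrix.cons_val_zero, Matrix.cons_val_one]

variable {m : ℕ} [NeZero m]

local notation "ℝᵐ" => EuclideanSpace ℝ (Fin m)

lemma sphericalMean_taylor_two (u : ℝᵐ → ℝ) (x : ℝᵐ) (r : ℝ) :
    sphericalMean x r (fun y => fderiv ℝ u x (y - x) +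
      (1 / 2 : ℝ) • fderiv ℝ (fderiv ℝ u) x (y - x) (y - x)) =
        r ^ 2 * (Laplacian.laplacian u x / (2 * m)) := by
  have hB := finrank_mul_integral_toSphere_bilinear (EuclideanSpace.basisFun (Fin m) ℝ)
    (fderiv ℝ (fderiv ℝ u) x)
  rw [← laplacian_eq_sum_fderiv, finrank_euclideanSpace_fin] at hB
  change _ = _ * sphereArea m at hB
  have hω := (sphereArea_pos (m := m)).ne'
  have hm : (m : ℝ) ≠ 0 := NeZero.ne _
  refine mul_left_cancel₀ hω ?_
  rw [sphereArea_mul_sphericalMean]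
  simp only [add_sub_cancel_left, map_smul, smul_apply, smul_eq_mul]
  rw [integral_add (Continuous.integrable_of_hasCompactSupport (by fun_prop) (.of_compactSpace _))
    (Continuous.integrable_of_hasCompactSupport (by fun_prop) (.of_compactSpace _))]
  simp only [integral_const_mul, integral_toSphere_clm, mul_zero, zero_add]
  field_simp
  linear_combination r ^ 2 * hB

lemma isLittleO_sphericalMean_of_isLittleO {f : ℝᵐ → ℝ} {x : ℝᵐ} {n : ℕ}
    (hf : f =o[𝓝 x] fun y => ‖y - x‖ ^ n) :
    (fun r => sphericalMean x r f) =o[𝓝[>] 0] fun r => r ^ n := by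
  refine isLittleO_iff.2 fun ε hε => ?_
  obtain ⟨δ, hδ, hball⟩ := Metric.eventually_nhds_iff_ball.1 (hf.def hε)
  filter_upwards [Ioo_mem_nhdsGT hδ] with r hr
  have hsphere : ∀ y : sphere (0 : ℝᵐ) 1, ‖f (x + r • (y : ℝᵐ))‖ ≤ ε * r ^ n := fun y => by
    have hy : x + r • (y : ℝᵐ) ∈ ball x δ := by
      rw [mem_ball', dist_self_add_smul_coe_sphere hr.1.le]
      exact hr.2
    simpa only [add_sub_cancel_left, norm_smul_coe_sphere hr.1.le, norm_pow,
      Real.norm_of_nonneg hr.1.le] using hball _ hy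
  have hω := sphereArea_pos (m := m)
  have hbound := norm_integral_le_of_norm_le_const
    (μ := (volume : Measure ℝᵐ).toSphere) (.of_forall hsphere)
  rw [← sphereArea_mul_sphericalMean, norm_mul, Real.norm_of_nonneg hω.le, mul_comm] at hbound
  rw [norm_pow, Real.norm_of_nonneg hr.1.le]
  exact le_of_mul_le_mul_right hbound hω

theorem tendsto_sphericalMean_sub_div_sq {u : ℝᵐ → ℝ} {x : ℝᵐ} (hu : ContDiffAt ℝ 2 u x) :
    Tendsto (fun r => (sphericalMean x r u - u x) / r ^ 2) (𝓝[>] 0)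
      (𝓝 (Laplacian.laplacian u x / (2 * m))) := by
  obtain ⟨δ, hδ, hball⟩ := Metric.eventually_nhds_iff_ball.1 (hu.eventually (by simp))
  have hremainder := (isLittleO_sphericalMean_of_isLittleO
    (isLittleO_sub_taylor_two hu)).tendsto_div_nhds_zero
  refine tendsto_sub_nhds_zero_iff.1 (hremainder.congr' ?_)
  filter_upwards [Ioo_mem_nhdsGT hδ] with r hr
  have hcont : ContinuousOn u (closedBall x r) := fun y hy =>
    (hball y (closedBall_subset_ball hr.2 hy)).continuousAt.continuousWithinAt
  have hr2 : r ^ 2 ≠ 0 := pow_ne_zero 2 hr.1.ne'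
  rw [sphericalMean_sub hr.1.le (hcont.fun_sub continuousOn_const) (by fun_prop),
    sphericalMean_sub hr.1.le hcont continuousOn_const, sphericalMean_const,
    sphericalMean_taylor_two, sub_div, mul_div_cancel_left₀ _ hr2]

theorem laplacian_add_eq_zero_of_sphericalMean_eq {lam : ℝ} {u : ℝᵐ → ℝ} {x : ℝᵐ}
    (hu : ContDiffAt ℝ 2 u x)
    (hmean : ∀ᶠ r in 𝓝[>] 0,
      sphericalMean x r u = u x * besselNormalized (((m : ℝ) - 2) / 2) (lam * r)) :
    Laplacian.laplacian u x + lam ^ 2 * u x = 0 := by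
  have hm : (m : ℝ) ≠ 0 := NeZero.ne _
  have hbessel := (tendsto_besselNormalized_sub_one_div_sq
    (neg_one_lt_natCast_sub_two_div_two (m := m)) lam).const_mul (u x)
  rw [show 4 * (((m : ℝ) - 2) / 2 + 1) = 2 * m by ring] at hbessel
  have hcongr : (fun r => u x * ((besselNormalized (((m : ℝ) - 2) / 2) (lam * r) - 1) / r ^ 2))
      =ᶠ[𝓝[>] 0] fun r => (sphericalMean x r u - u x) / r ^ 2 :=
    hmean.mono fun r hr => by simp only [hr]; ring
  have hlim := tendsto_nhds_unique (tendsto_sphericalMean_sub_div_sq hu) (hbessel.congr' hcongr)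
  field_simp at hlim
  linear_combination hlim

end Laplacian

end Metaharmonic

theorem theorem4p4_general (m : ℕ) [NeZero m] (D : Set (EuclideanSpace ℝ (Fin m)))
    (hDopen : IsOpen D) (lam : ℝ) (hlam : 0 < lam)
    (u : EuclideanSpace ℝ (Fin m) → ℝ) (hu : ContinuousOn u D)
    (h : ∀ x ∈ D, ∀ r₁ r₂ : ℝ, 0 < r₁ → r₁ < r₂ →
      r₂ < Metaharmonic.besselFirstZero (((m : ℝ) - 2) / 2) / lam →
      Metric.closedBall x r₂ ⊆ D →
      (∀ r ∈ Set.Ioo r₁ r₂, Metaharmonic.AnnularIdentity lam u x r₁ r₂ r) ∨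
        Metaharmonic.AnnularIdentity lam u x r₁ r₂ r₁ ∨
        Metaharmonic.AnnularIdentity lam u x r₁ r₂ r₂) :
    Metaharmonic.IsMetaharmonicOn lam u D := by
  have hν := Metaharmonic.neg_one_lt_natCast_sub_two_div_two (m := m)
  have hρ := div_pos (Metaharmonic.besselFirstZero_pos hν) hlam
  have hcont := Metaharmonic.continuous_besselNormalized (((m : ℝ) - 2) / 2)
  have hmean : ∀ x, ∀ R ∈ Set.Ioo 0 (Metaharmonic.besselFirstZero (((m : ℝ) - 2) / 2) / lam),
      Metric.closedBall x R ⊆ D → Metaharmonic.sphericalMean x R u =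
        u x * Metaharmonic.besselNormalized (((m : ℝ) - 2) / 2) (lam * R) :=
    fun x R hR hRD => Metaharmonic.sphericalMean_eq_of_annularIdentity hlam hR.1 hR.2
      (hu.mono hRD) fun r₁ r₂ h₁ h₁₂ h₂ => h x (hRD (Metric.mem_closedBall_self hR.1.le)) r₁ r₂ h₁
        h₁₂ (h₂.trans_lt hR.2) ((Metric.closedBall_subset_closedBall h₂).trans hRD)
  have hsmooth : ∀ x ∈ D, ContDiffAt ℝ 2 u x := fun x hx =>
    Metaharmonic.contDiffAt_of_sphericalMean_eq hDopen hu (by fun_prop) hρ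
      (fun r hr => Metaharmonic.besselNormalized_mul_pos hν hlam hr.1.le hr.2) hmean hx
  refine ⟨fun x hx => (hsmooth x hx).contDiffWithinAt, fun x hx =>
    Metaharmonic.laplacian_add_eq_zero_of_sphericalMean_eq (hsmooth x hx) ?_⟩
  obtain ⟨δ, hδ, hδD⟩ := Metric.nhds_basis_closedBall.mem_iff.1 (hDopen.mem_nhds hx)
  filter_upwards [Ioo_mem_nhdsGT hρ, Ioo_mem_nhdsGT hδ] with r hr hrδ
  exact hmean x r hr ((Metric.closedBall_subset_closedBall hrδ.2.le).trans hδD)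

theorem theorem4p4 (m : ℕ) (hm : 2 ≤ m) (D : Set (EuclideanSpace ℝ (Fin m)))
    (hDopen : IsOpen D) (hDconn : IsConnected D) (hDbdd : Bornology.IsBounded D)
    (lam : ℝ) (hlam : 0 < lam)
    (u : EuclideanSpace ℝ (Fin m) → ℝ) (hu : ContinuousOn u D)
    (h : ∀ x ∈ D, ∀ r₁ r₂ : ℝ, 0 < r₁ → r₁ < r₂ →
      r₂ < Metaharmonic.besselFirstZero (((m : ℝ) - 2) / 2) / lam →
      Metric.closedBall x r₂ ⊆ D →
      (∀ r ∈ Set.Ioo r₁ r₂, Metaharmonic.AnnularIdentity lam u x r₁ r₂ r) ∨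
        Metaharmonic.AnnularIdentity lam u x r₁ r₂ r₁ ∨
        Metaharmonic.AnnularIdentity lam u x r₁ r₂ r₂) :
    Metaharmonic.IsMetaharmonicOn lam u D := by
  have : NeZero m := ⟨by omega⟩
  exact theorem4p4_general m D hDopen lam hlam u hu h
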